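/- **Setting.** Let $d\ge 1$ and let $A$ be a $d\times d$ integer matrix all of whose complex eigenvalues are greater than $1$ in absolute value (a dilation matrix) and which is isotropic: diagonalizable over $\mathbb C$ with all eigenvalues of equal absolute value. Put $q=|\det A|$, and let $A^{-T}=(A^T)^{-1}=q^{-1/d}\,Q^{-1}UQ$ with $U$ real orthogonal and $Q$ real symmetric positive definite. Write $Q^2=(q_{ij})$ and let $$P(\xi)=\xi^TQ^2\xi=\sum_i q_{ii}\xi_i^2+2\sum_{i<j}q_{ij}\xi_i\xi_j,\qquad G(\xi)=4\sum_{i}q_{ii}\sin^2\tfrac{\xi_i}{2}+2\sum_{i<j}q_{ij}\sin\xi_i\sin\xi_j .$$ Let $\mathcal S=\{s\in[0,1)^d: A^Ts\in\mathbb Z^d\}$ and $$m_0(\xi)=\frac{\prod_{s\in\mathcal S\setminus\{0\}}G(\xi+2\pi s)}{\prod_{s\in\mathcal S\setminus\{0\}}G(2\pi s)},\qquad \hat\phi(\xi)=\prod_{j=1}^\infty m_0\big((A^{-T})^j\xi\big),$$ $$\mu(\xi)=\frac{q^{2/d}\,m_0(A^{-T}\xi)\,G(A^{-T}\xi)}{G(\xi)}\quad(\mu=1\text{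 at the removable singularities, the zeros of }G),\qquad M(\xi)=\prod_{j=0}^\infty \mu\big((A^{-T})^j\xi\big).$$ The Fourier transform is $\hat f(\xi)=\int_{\mathbb R^d} f(x)e^{-i\xi\cdot x}\,dx$, extended to tempered distributions by duality. For $m\ge1$ the elliptic scaling function $\phi^m\in\mathcal S'(\mathbb R^d)$ is defined by $\widehat{\phi^m}=(\hat\phi)^m$. Let $\Delta^\sharp$ be the operator with symbol $P(\xi)/M(\xi)$: it is defined on those $T\in\mathcal S'(\mathbb R^d)$ for which $\hat T$ is a function $f$ such that $\frac PM f$ is again a tempered distribution, and then $\widehat{\Delta^\sharp T}=\frac PM f$; $(\Delta^\sharp)^k$ is its $k$-fold iterate. On tempered distributions let $$\mathcal D_j^2f=f(\cdot-e_j)-2f+f(\cdot+e_j),$$ $$\mathcal D_{ij}f=\tfrac14\big(f(\cdot-e_i-e_j)+f(\cdot+e_i+e_j)-f(\cdot-e_i+e_j)-f(\cdot+e_i-e_j)\big)\quad(i\neq j),$$ $$\mathcal G=-P(\mathcal D_1,\dots,\mathcal D_d):=-\sum_i q_{ii}\mathcal D_i^2-2\sum_{i<j}q_{ij}\mathcal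 D_{ij}.$$ **Theorem.** For every $m\ge1$ the function $(\hat\phi)^m$ is the Fourier transform of a tempered distribution, so that $\phi^m$ is well defined. The finite-difference operator $\mathcal G$ has the symbol $G$: $\widehat{\mathcal G T}=G\,\hat T$ for all $T\in\mathcal S'(\mathbb R^d)$, where $G$ is smooth and has, with all its derivatives, at most polynomial growth. For all integers $0\le k<m$ the distribution $\phi^m$ lies in the domain of $(\Delta^\sharp)^k$, and $$(\Delta^\sharp)^k\phi^m=\mathcal G^k\phi^{m-k}.$$ -/

import Mathlib

open MeasureTheory
open scoped SchwartzMap FourierTransform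

noncomputable section

namespace EllipticScaling

/-! ### Isotropic dilation matrices, the quadratic form and the mask -/

/-- The real matrix with the same entries as an integer matrix. -/
def realMat {d : ℕ} (A : Matrix (Fin d) (Fin d) ℤ) : Matrix (Fin d) (Fin d) ℝ :=
  A.map (fun n : ℤ => (n : ℝ))

/-- A dilation matrix: an integer matrix all of whose (complex) eigenvalues are greater than one
in absolute value. -/
def IsDilation {d : ℕ} (A : Matrix (Fin d) (Fin d) ℤ) : Prop :=
  ∀ z ∈ spectrum ℂ (A.map (fun n : ℤ => (n : ℂ))), 1 < ‖z‖

/-- An isotropic matrix: it is diagonalizable over `ℂ` and all its eigenvalues are equal in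
absolute value. -/
def IsIsotropic {d : ℕ} (B : Matrix (Fin d) (Fin d) ℝ) : Prop :=
  ∃ (V : Matrix (Fin d) (Fin d) ℂ) (v : Fin d → ℂ), IsUnit V.det ∧
    B.map (fun x : ℝ => (x : ℂ)) = V * Matrix.diagonal v * V⁻¹ ∧ ∀ i j, ‖v i‖ = ‖v j‖

/-- `q = |det A|`, as a real number. -/
def absDet {d : ℕ} (A : Matrix (Fin d) (Fin d) ℤ) : ℝ := |(A.det : ℝ)|

/-- The matrix `A^{-T}`. -/
def invTr {d : ℕ} (A : Matrix (Fin d) (Fin d) ℤ) : Matrix (Fin d) (Fin d) ℝ :=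
  ((realMat A).transpose)⁻¹

/-- The quadratic form `P(x) = xᵀ Q² x`. -/
def quadForm {d : ℕ} (Q : Matrix (Fin d) (Fin d) ℝ) (x : Fin d → ℝ) : ℝ :=
  x ⬝ᵥ ((Q * Q).mulVec x)

/-- The trigonometric polynomial
`G(ξ) = 4 ∑ i, q_ii sin² (ξ_i / 2) + 2 ∑ i < j, q_ij sin ξ_i sin ξ_j`, with `Q² = (q_ij)`. -/
def trigPoly {d : ℕ} (Q : Matrix (Fin d) (Fin d) ℝ) (ξ : Fin d → ℝ) : ℝ :=
  4 * ∑ i, (Q * Q) i i * Real.sin (ξ i / 2) ^ 2 +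
    2 * ∑ i, ∑ j ∈ Finset.Ioi i, (Q * Q) i j * (Real.sin (ξ i) * Real.sin (ξ j))

/-- The set `S(Aᵀ)`: the points `s` of `[0,1)^d` such that `Aᵀ s` is an integer vector. Then
`Aᵀ S(Aᵀ) = ℤ^d ∩ Aᵀ [0,1)^d` is a full set of representatives of `ℤ^d / Aᵀ ℤ^d`. -/
def digitPoints {d : ℕ} (A : Matrix (Fin d) (Fin d) ℤ) : Set (Fin d → ℝ) :=
  {s | (∀ i, 0 ≤ s i ∧ s i < 1) ∧
    ∃ n : Fin d → ℤ, (realMat A).transpose.mulVec s = fun i => (n i : ℝ)}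

/-- The mask `m₀`. -/
def mask {d : ℕ} (A : Matrix (Fin d) (Fin d) ℤ) (Q : Matrix (Fin d) (Fin d) ℝ)
    (ξ : Fin d → ℝ) : ℝ :=
  (∏ᶠ s ∈ digitPoints A \ {0}, trigPoly Q (ξ + (2 * Real.pi) • s)) /
    (∏ᶠ s ∈ digitPoints A \ {0}, trigPoly Q ((2 * Real.pi) • s))

/-- The Fourier transform `φ^(ξ) = ∏_{j ≥ 1} m₀((A^{-T})^j ξ)` of the scaling function with
mask `m₀`. -/
def phiHat {d : ℕ} (A : Matrix (Fin d) (Fin d) ℤ) (Q : Matrix (Fin d) (Fin d) ℝ)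
    (ξ : Fin d → ℝ) : ℝ :=
  ∏' j : ℕ, mask A Q ((invTr A ^ (j + 1)).mulVec ξ)

open Classical in
/-- The function `μ(ξ) = q^{2/d} m₀(A^{-T} ξ) G(A^{-T} ξ) / G(ξ)`, with the value `1` at the
removable singularities, which are the zeros `2πk` (`k ∈ ℤ^d`) of `G`. -/
def mu {d : ℕ} (A : Matrix (Fin d) (Fin d) ℤ) (Q : Matrix (Fin d) (Fin d) ℝ)
    (ξ : Fin d → ℝ) : ℝ :=
  if trigPoly Q ξ = 0 then 1
  else absDet A ^ ((2 : ℝ) / (d : ℝ)) * mask A Q ((invTr A).mulVec ξ) *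
    trigPoly Q ((invTr A).mulVec ξ) / trigPoly Q ξ

/-- The function `M(ξ) = ∏_{j ≥ 0} μ((A^{-T})^j ξ)`. -/
def bigM {d : ℕ} (A : Matrix (Fin d) (Fin d) ℤ) (Q : Matrix (Fin d) (Fin d) ℝ)
    (ξ : Fin d → ℝ) : ℝ :=
  ∏' j : ℕ, mu A Q ((invTr A ^ j).mulVec ξ)

/-! ### The Fourier transform of tempered distributions -/

/-- `ℝ^d` with the Euclidean norm. -/
abbrev Sp (d : ℕ) : Type := EuclideanSpace ℝ (Fin d)

/-- The dilation `x ↦ (2π)⁻¹ x`. -/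
def scaleEquiv (d : ℕ) : Sp d ≃L[ℝ] Sp d :=
  ContinuousLinearEquiv.smulLeft (Units.mk0 ((2 * Real.pi)⁻¹) (by positivity))

/-- The Fourier transform `f^(ξ) = ∫ f(x) exp (- i ξ·x) dx` on the Schwartz space (see
`fourierS_apply`). -/
def fourierS (d : ℕ) : 𝓢(Sp d, ℂ) →L[ℂ] 𝓢(Sp d, ℂ) :=
  (SchwartzMap.compCLMOfContinuousLinearEquiv ℂ (scaleEquiv d)).comp
    (FourierTransform.fourierCLM ℂ 𝓢(Sp d, ℂ))

theorem fourierS_apply {d : ℕ} (f : 𝓢(Sp d, ℂ)) (ξ : Sp d) :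
    fourierS d f ξ = ∫ x : Sp d, f x * Complex.exp (-(Complex.I * ((∑ i, ξ i * x i : ℝ) : ℂ))) := by
  have h : fourierS d f ξ = 𝓕 (f : Sp d → ℂ) ((2 * Real.pi)⁻¹ • ξ) := by
    rw [← SchwartzMap.fourier_coe]; rfl
  rw [h, Real.fourier_eq']
  refine integral_congr_ae (Filter.Eventually.of_forall fun x => ?_)
  simp only [smul_eq_mul]
  rw [mul_comm]
  congr 2
  rw [inner_smul_right, PiLp.inner_apply]
  have hp : (Real.pi : ℂ) ≠ 0 := by exact_mod_cast Real.pi_ne_zero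
  simp only [RCLike.inner_apply, conj_trivial]
  push_cast
  field_simp

/-- The Fourier transform of tempered distributions, by duality. -/
def fourierD (d : ℕ) : 𝓢'(Sp d, ℂ) →L[ℂ] 𝓢'(Sp d, ℂ) :=
  PointwiseConvergenceCLM.precomp ℂ (fourierS d)

theorem fourierD_injective (d : ℕ) : Function.Injective (fourierD d) := by
  intro S T h
  ext f
  have hsurj : ∃ g, fourierS d g = f := by
    refine ⟨𝓕⁻ (SchwartzMap.compCLMOfContinuousLinearEquiv ℂ (scaleEquiv d).symm f), ?_⟩
    ext x
    simp [fourierS]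
  obtain ⟨g, rfl⟩ := hsurj
  exact congrArg (fun R : 𝓢'(Sp d, ℂ) => R g) h

/-- The tempered distribution `T` is (the regular distribution given by) the function `f`. -/
def Represents {d : ℕ} (f : Sp d → ℂ) (T : 𝓢'(Sp d, ℂ)) : Prop :=
  ∀ ψ : 𝓢(Sp d, ℂ), Integrable (fun x => f x * ψ x) ∧ T ψ = ∫ x, f x * ψ x

theorem Represents.ae_eq {d : ℕ} {f g : Sp d → ℂ} {T : 𝓢'(Sp d, ℂ)}
    (hf : Represents f T) (hg : Represents g T) : f =ᵐ[volume] g := by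
  have key : ∀ {f : Sp d → ℂ}, Represents f T → LocallyIntegrable f := by
    intro f hf x
    obtain ⟨b⟩ : Nonempty (ContDiffBump x) := inferInstance
    have hb₁ : HasCompactSupport (Complex.ofRealCLM ∘ b) := b.hasCompactSupport.comp_left rfl
    have hb₂ : ContDiff ℝ (⊤ : ℕ∞) (Complex.ofRealCLM ∘ b) :=
      Complex.ofRealCLM.contDiff.comp b.contDiff
    have hi := (hf (hb₁.toSchwartzMap hb₂)).1
    refine ⟨Metric.ball x b.rIn, Metric.ball_mem_nhds x b.rIn_pos, ?_⟩
    refine (hi.integrableOn (s := Metric.ball x b.rIn)).congr_fun ?_ measurableSet_ball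
    intro y hy
    have : b y = 1 := b.one_of_mem_closedBall (Metric.ball_subset_closedBall hy)
    simp [this]
  have hz := ae_eq_zero_of_integral_contDiff_smul_eq_zero ((key hf).sub (key hg)) (μ := volume) ?_
  · filter_upwards [hz] with x hx
    exact sub_eq_zero.mp hx
  · intro b hb hbc
    have hb₁ : HasCompactSupport (Complex.ofRealCLM ∘ b) := hbc.comp_left rfl
    have hb₂ : ContDiff ℝ (⊤ : ℕ∞) (Complex.ofRealCLM ∘ b) := Complex.ofRealCLM.contDiff.comp hb
    obtain ⟨h1, h2⟩ := hf (hb₁.toSchwartzMap hb₂)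
    obtain ⟨h3, h4⟩ := hg (hb₁.toSchwartzMap hb₂)
    have h5 := integral_sub h1 h3
    rw [← h2, ← h4, sub_self] at h5
    rw [← h5]
    refine integral_congr_ae (Filter.Eventually.of_forall fun x => ?_)
    simp only [Pi.sub_apply, Complex.real_smul, HasCompactSupport.toSchwartzMap_toFun,
      Function.comp_apply, Complex.ofRealCLM_apply]
    ring

open Classical in
/-- The tempered distribution whose Fourier transform is the function `f` (and `0` if there is no
such distribution). -/
def invFourierOf {d : ℕ} (f : Sp d → ℂ) : 𝓢'(Sp d, ℂ) :=
  if h : ∃ T : 𝓢'(Sp d, ℂ), Represents f (fourierD d T) then h.choose else 0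

/-! ### The elliptic scaling functions -/

/-- A real function of `d` real variables, as a complex valued function on Euclidean space. -/
def toCplx {d : ℕ} (f : (Fin d → ℝ) → ℝ) : Sp d → ℂ := fun ξ => (f (fun i => ξ i) : ℂ)

/-- The elliptic scaling function `φ^m`, the tempered distribution whose Fourier transform is
`(φ^(ξ))^m`. -/
def phi {d : ℕ} (A : Matrix (Fin d) (Fin d) ℤ) (Q : Matrix (Fin d) (Fin d) ℝ) (m : ℕ) :
    𝓢'(Sp d, ℂ) :=
  invFourierOf (toCplx fun ξ => phiHat A Q ξ ^ m)

/-! ### Operators -/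

/-- The relation `S = σ(D) T` for a measurable symbol `σ`: the Fourier transform of `T` is a
function `f`, and that of `S` is the function `σ f`. -/
def MultiplierRel {d : ℕ} (σ : Sp d → ℂ) (T S : 𝓢'(Sp d, ℂ)) : Prop :=
  ∃ f : Sp d → ℂ, Represents f (fourierD d T) ∧
    Represents (fun ξ => σ ξ * f ξ) (fourierD d S)

theorem MultiplierRel.unique {d : ℕ} {σ : Sp d → ℂ} {T S S' : 𝓢'(Sp d, ℂ)}
    (h : MultiplierRel σ T S) (h' : MultiplierRel σ T S') : S = S' := by
  obtain ⟨f, hf, hS⟩ := h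
  obtain ⟨g, hg, hS'⟩ := h'
  have hfg := hf.ae_eq hg
  apply fourierD_injective d
  ext ψ
  rw [(hS ψ).2, (hS' ψ).2]
  refine integral_congr_ae ?_
  filter_upwards [hfg] with x hx
  rw [hx]

/-- The (partially defined) operator with symbol `σ`, on the tempered distributions `T` whose
Fourier transform is a function `f` such that `σ f` is again a tempered distribution. -/
def multiplier {d : ℕ} (σ : Sp d → ℂ) : 𝓢'(Sp d, ℂ) →. 𝓢'(Sp d, ℂ) :=
  fun T => ⟨∃ S, MultiplierRel σ T S, fun h => h.choose⟩

theorem mem_multiplier_iff {d : ℕ} {σ : Sp d → ℂ} {T S : 𝓢'(Sp d, ℂ)} :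
    S ∈ multiplier σ T ↔ MultiplierRel σ T S := by
  constructor
  · rintro ⟨h, rfl⟩
    exact h.choose_spec
  · intro h
    exact ⟨⟨S, h⟩, (Exists.choose_spec (⟨S, h⟩ : ∃ S, MultiplierRel σ T S)).unique h⟩

/-- The powers (iterates) of a partially defined operator. -/
def partialPow {α : Type*} (F : α →. α) : ℕ → (α →. α)
  | 0 => PFun.id α
  | k + 1 => F.comp (partialPow F k)

/-- The operator `Δ^♯`, with symbol `P(ξ) / M(ξ)`. -/
def deltaSharp {d : ℕ} (A : Matrix (Fin d) (Fin d) ℤ) (Q : Matrix (Fin d) (Fin d) ℝ) :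
    𝓢'(Sp d, ℂ) →. 𝓢'(Sp d, ℂ) :=
  multiplier (toCplx fun ξ => quadForm Q ξ / bigM A Q ξ)

/-- The shift `f ↦ f(· - v)` on tempered distributions. -/
def shift {d : ℕ} (v : Sp d) : 𝓢'(Sp d, ℂ) →L[ℂ] 𝓢'(Sp d, ℂ) :=
  PointwiseConvergenceCLM.precomp ℂ (SchwartzMap.compSubConstCLM ℂ (-v))

/-- The basis vector `e_j`. -/
def basisVec {d : ℕ} (j : Fin d) : Sp d := EuclideanSpace.single j (1 : ℝ)

/-- `𝒟_j² f = f(· - e_j) - 2 f + f(· + e_j)`. -/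
def diffSq {d : ℕ} (j : Fin d) : 𝓢'(Sp d, ℂ) →L[ℂ] 𝓢'(Sp d, ℂ) :=
  shift (basisVec j) - (2 : ℂ) • ContinuousLinearMap.id ℂ _ + shift (-basisVec j)

/-- `𝒟_ij f = (f(· - e_i - e_j) + f(· + e_i + e_j) - f(· - e_i + e_j) - f(· + e_i - e_j)) / 4`. -/
def diffMixed {d : ℕ} (i j : Fin d) : 𝓢'(Sp d, ℂ) →L[ℂ] 𝓢'(Sp d, ℂ) :=
  (1 / 4 : ℂ) • (shift (basisVec i + basisVec j) + shift (-basisVec i - basisVec j)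
    - shift (basisVec i - basisVec j) - shift (-basisVec i + basisVec j))

/-- The finite-difference operator
`𝒢 = -P(𝒟_1, …, 𝒟_d) = -(∑ i, q_ii 𝒟_i² + 2 ∑ i < j, q_ij 𝒟_ij)`, with `Q² = (q_ij)`. -/
def diffOp {d : ℕ} (Q : Matrix (Fin d) (Fin d) ℝ) : 𝓢'(Sp d, ℂ) →L[ℂ] 𝓢'(Sp d, ℂ) :=
  -((∑ i, ((Q * Q) i i : ℂ) • diffSq i) +
    (2 : ℂ) • ∑ i, ∑ j ∈ Finset.Ioi i, ((Q * Q) i j : ℂ) • diffMixed i j)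

/-- The operator `L` on tempered distributions has the smooth symbol `g`: in the Fourier domain,
it is the multiplication by `g`. -/
def HasSmoothSymbol {d : ℕ} (L : 𝓢'(Sp d, ℂ) →L[ℂ] 𝓢'(Sp d, ℂ)) (g : Sp d → ℂ) : Prop :=
  g.HasTemperateGrowth ∧
    ∀ T : 𝓢'(Sp d, ℂ), fourierD d (L T) = TemperedDistribution.smulLeftCLM ℂ g (fourierD d T)

end EllipticScaling

end

open MeasureTheory
open scoped SchwartzMap FourierTransform

noncomputable section

namespace EllipticScaling

/-! ### The Fourier transform and multiplication operators -/

/-! Everything reduces to a pointwise identity between Fourier transforms. Write B = A^{-T}, r =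
q^{-1/d} and R = G/P. The factorization of B makes it scale the norm P^{1/2} by exactly r
(`quadNorm_mulVec_of_eq`), so q^{2/d} = P(y)/P(By) and μ(y) = m₀(By) · R(By)/R(y). The quotients of
R telescope along the orbit of B, and R → 1 at the origin because G - P = O(|x|³). Hence M = φ^ ·
P/G off the zeros of G (`bigM_eq`).

Consequently (P/M) (φ^)^(m+1) = G (φ^)^m wherever G ≠ 0. The zeros of G form the countable set
2πℤ^d, hence a null set, because G is P(sin x) plus a positive combination of the sin⁴(x_i/2). Where
φ^ = 0 both sides vanish, provided m ≥ 1; this is why k < m is required. Multiplying by G^k gives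
the step Δ^♯ 𝒢^k φ^(m+1) = 𝒢^(k+1) φ^m (`deltaSharp_diffOp_pow_phi`), and induction on k finishes.

Two facts make this meaningful for distributions. The symbol of 𝒢 follows from that of a shift, a
character. And φ^ is nonnegative, measurable and of polynomial growth (`exists_phiHat_le`), since m₀
is bounded and φ^(x) = m₀(Bx) φ^(Bx). -/

theorem hasTemperateGrowth_cexp_neg_I :
    (fun t : ℝ => Complex.exp (-(Complex.I * (t : ℂ)))).HasTemperateGrowth := by
  have hd : ∀ n : ℕ, iteratedDeriv n (fun t : ℝ => Complex.exp (-(Complex.I * (t : ℂ)))) =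
      fun t : ℝ => (-Complex.I) ^ n * Complex.exp (-(Complex.I * (t : ℂ))) := by
    intro n
    induction n with
    | zero => simp
    | succ n ih =>
      rw [iteratedDeriv_succ, ih]
      funext t
      have h1 : HasDerivAt (fun t : ℝ => -(Complex.I * (t : ℂ))) (-(Complex.I * 1)) t :=
        ((Complex.ofRealCLM.hasDerivAt (x := t)).const_mul Complex.I).neg
      rw [(h1.cexp.const_mul ((-Complex.I) ^ n)).deriv]
      ring
  refine ⟨?_, fun n => ⟨0, 1, fun t => ?_⟩⟩
  · exact Complex.contDiff_exp.comp
      (contDiff_const.mul Complex.ofRealCLM.contDiff).neg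
  · rw [norm_iteratedFDeriv_eq_norm_iteratedDeriv, hd]
    simp [Complex.norm_exp]

/-- The character `ξ ↦ exp (- i v·ξ)`. -/
def character {d : ℕ} (v : Sp d) : Sp d → ℂ :=
  fun ξ => Complex.exp (-(Complex.I * ((∑ i, ξ i * v i : ℝ) : ℂ)))

theorem hasTemperateGrowth_character {d : ℕ} (v : Sp d) : (character v).HasTemperateGrowth := by
  have h := hasTemperateGrowth_cexp_neg_I.comp (innerSL ℝ v).hasTemperateGrowth
  convert h using 1
  funext ξ
  simp only [character, Function.comp_apply, innerSL_apply_apply, PiLp.inner_apply,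
    RCLike.inner_apply, conj_trivial]

/-- Modulation turns into translation because the two exponentials multiply. By transposition this
is the symbol of `shift v`, whose action on test functions is x ↦ x + v; hence the sign in -v. -/
theorem fourierS_smulLeftCLM_character {d : ℕ} (v : Sp d) (ψ : 𝓢(Sp d, ℂ)) :
    fourierS d (SchwartzMap.smulLeftCLM ℂ (character v) ψ) =
      SchwartzMap.compSubConstCLM ℂ (-v) (fourierS d ψ) := by
  ext x
  rw [SchwartzMap.compSubConstCLM_apply, fourierS_apply, fourierS_apply]
  refine integral_congr_ae (Filter.Eventually.of_forall fun y => ?_)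
  simp only [SchwartzMap.smulLeftCLM_apply_apply (hasTemperateGrowth_character v), character,
    smul_eq_mul, sub_neg_eq_add, PiLp.add_apply, add_mul, Finset.sum_add_distrib]
  rw [mul_comm, ← mul_assoc, mul_comm _ (ψ y), ← Complex.exp_add]
  congr 2
  have : ∑ i, y i * v i = ∑ i, v i * y i := Finset.sum_congr rfl fun i _ => mul_comm _ _
  rw [this]
  push_cast
  ring

theorem hasSmoothSymbol_shift {d : ℕ} (v : Sp d) : HasSmoothSymbol (shift v) (character v) := by
  refine ⟨hasTemperateGrowth_character v, fun T => ?_⟩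
  ext ψ
  change T (SchwartzMap.compSubConstCLM ℂ (-v) (fourierS d ψ)) =
    T (fourierS d (SchwartzMap.smulLeftCLM ℂ (character v) ψ))
  rw [fourierS_smulLeftCLM_character]

namespace HasSmoothSymbol

variable {d : ℕ} {L L' : 𝓢'(Sp d, ℂ) →L[ℂ] 𝓢'(Sp d, ℂ)} {g g' : Sp d → ℂ}

theorem id : HasSmoothSymbol (ContinuousLinearMap.id ℂ 𝓢'(Sp d, ℂ)) (fun _ => 1) := by
  refine ⟨.const 1, fun T => ?_⟩
  rw [TemperedDistribution.smulLeftCLM_const, one_smul, ContinuousLinearMap.id_apply]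

theorem add (h : HasSmoothSymbol L g) (h' : HasSmoothSymbol L' g') :
    HasSmoothSymbol (L + L') (g + g') := by
  refine ⟨h.1.add h'.1, fun T => ?_⟩
  rw [TemperedDistribution.smulLeftCLM_add h.1 h'.1, add_apply, map_add, h.2, h'.2, add_apply]

theorem neg (h : HasSmoothSymbol L g) : HasSmoothSymbol (-L) (-g) := by
  refine ⟨h.1.neg, fun T => ?_⟩
  rw [TemperedDistribution.smulLeftCLM_neg h.1, neg_apply, map_neg, h.2, neg_apply]

theorem sub (h : HasSmoothSymbol L g) (h' : HasSmoothSymbol L' g') :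
    HasSmoothSymbol (L - L') (g - g') := by
  simpa only [sub_eq_add_neg] using h.add h'.neg

theorem smul (c : ℂ) (h : HasSmoothSymbol L g) : HasSmoothSymbol (c • L) (c • g) := by
  refine ⟨(Function.HasTemperateGrowth.const c).mul h.1, fun T => ?_⟩
  rw [TemperedDistribution.smulLeftCLM_smul h.1, smul_apply, map_smul, h.2, smul_apply]

theorem sum {ι : Type*} {s : Finset ι} {L : ι → 𝓢'(Sp d, ℂ) →L[ℂ] 𝓢'(Sp d, ℂ)}
    {g : ι → Sp d → ℂ} (h : ∀ i ∈ s, HasSmoothSymbol (L i) (g i)) :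
    HasSmoothSymbol (∑ i ∈ s, L i) (fun x => ∑ i ∈ s, g i x) := by
  refine ⟨.sum fun i hi => (h i hi).1, fun T => ?_⟩
  rw [TemperedDistribution.smulLeftCLM_sum fun i hi => (h i hi).1, sum_apply, map_sum, sum_apply]
  exact Finset.sum_congr rfl fun i hi => (h i hi).2 T

end HasSmoothSymbol

theorem character_basisVec_comb {d : ℕ} (i j : Fin d) (a b : ℝ) (ξ : Sp d) :
    character (a • basisVec i + b • basisVec j) ξ =
      Complex.exp (-(Complex.I * ((a * ξ i + b * ξ j : ℝ) : ℂ))) := by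
  have h : ∑ k, ξ k * (a • basisVec i + b • basisVec j : Sp d) k = a * ξ i + b * ξ j := by
    simp [basisVec, add_mul, Finset.sum_add_distrib, mul_comm (ξ _)]
  rw [character, h]

theorem hasSmoothSymbol_diffSq {d : ℕ} (j : Fin d) :
    HasSmoothSymbol (diffSq j) (toCplx fun ξ => -(4 * Real.sin (ξ j / 2) ^ 2)) := by
  -- The hole is filled by the symbol that the rules for sums and multiples produce, a combination
  -- of exponentials; what remains is a trigonometric identity.
  have h : HasSmoothSymbol (diffSq j) _ := ((hasSmoothSymbol_shift (basisVec j)).sub (HasSmoothSymbol.id.smul 2)).add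
    (hasSmoothSymbol_shift (-basisVec j))
  convert h using 1
  funext ξ
  have h1 := character_basisVec_comb j j 1 0 ξ
  have h2 := character_basisVec_comb j j (-1) 0 ξ
  simp only [zero_smul, one_smul, neg_smul, add_zero, one_mul, zero_mul, neg_mul] at h1 h2
  simp only [toCplx, Pi.add_apply, Pi.sub_apply, Pi.smul_apply, smul_eq_mul, mul_one, h1, h2]
  have hs : 4 * Real.sin (ξ j / 2) ^ 2 = 2 - 2 * Real.cos (ξ j) := by
    rw [Real.sin_sq_eq_half_sub]
    ring_nf
  rw [hs]
  push_cast
  rw [Complex.cos]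
  ring_nf

theorem hasSmoothSymbol_diffMixed {d : ℕ} (i j : Fin d) :
    HasSmoothSymbol (diffMixed i j)
      (toCplx fun ξ => -(Real.sin (ξ i) * Real.sin (ξ j))) := by
  have h : HasSmoothSymbol (diffMixed i j) _ := ((((hasSmoothSymbol_shift (basisVec i + basisVec j)).add
    (hasSmoothSymbol_shift (-basisVec i - basisVec j))).sub
    (hasSmoothSymbol_shift (basisVec i - basisVec j))).sub
    (hasSmoothSymbol_shift (-basisVec i + basisVec j))).smul (1 / 4)
  convert h using 1
  funext ξ
  have h1 := character_basisVec_comb i j 1 1 ξ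
  have h2 := character_basisVec_comb i j (-1) (-1) ξ
  have h3 := character_basisVec_comb i j 1 (-1) ξ
  have h4 := character_basisVec_comb i j (-1) 1 ξ
  simp only [one_smul, neg_smul, one_mul, neg_mul, ← sub_eq_add_neg] at h1 h2 h3 h4
  simp only [toCplx, Pi.add_apply, Pi.sub_apply, Pi.smul_apply, smul_eq_mul, h1, h2, h3, h4]
  push_cast
  simp only [Complex.sin, mul_add, neg_add, mul_neg, neg_neg, sub_eq_add_neg,
    Complex.exp_add]
  ring_nf
  rw [Complex.I_sq]
  ring_nf

theorem hasSmoothSymbol_diffOp {d : ℕ} (Q : Matrix (Fin d) (Fin d) ℝ) :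
    HasSmoothSymbol (diffOp Q) (toCplx (trigPoly Q)) := by
  have h1 : HasSmoothSymbol (∑ i, ((Q * Q) i i : ℂ) • diffSq i) _ :=
    .sum fun i _ => (hasSmoothSymbol_diffSq i).smul ((Q * Q) i i : ℂ)
  have h2 : HasSmoothSymbol (∑ i, ∑ j ∈ Finset.Ioi i, ((Q * Q) i j : ℂ) • diffMixed i j) _ :=
    .sum fun i _ => .sum fun j _ => (hasSmoothSymbol_diffMixed i j).smul ((Q * Q) i j : ℂ)
  have h : HasSmoothSymbol (diffOp Q) _ := (h1.add (h2.smul 2)).neg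
  convert h using 1
  funext ξ
  simp only [toCplx, trigPoly, Pi.neg_apply, Pi.add_apply, Pi.smul_apply, smul_eq_mul]
  push_cast
  simp only [mul_neg, Finset.sum_neg_distrib, neg_add, neg_neg, Finset.mul_sum]
  congr 1
  refine Finset.sum_congr rfl fun i _ => ?_
  ring

/-! ### Functions as tempered distributions -/

theorem fourierD_surjective (d : ℕ) : Function.Surjective (fourierD d) := by
  intro T
  let inv : 𝓢(Sp d, ℂ) →L[ℂ] 𝓢(Sp d, ℂ) :=
    (FourierTransform.fourierInvCLM ℂ 𝓢(Sp d, ℂ)).comp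
      (SchwartzMap.compCLMOfContinuousLinearEquiv ℂ (scaleEquiv d).symm)
  refine ⟨PointwiseConvergenceCLM.precomp ℂ inv T, ?_⟩
  ext ψ
  change T (inv (fourierS d ψ)) = T ψ
  congr 1
  have : SchwartzMap.compCLMOfContinuousLinearEquiv ℂ (scaleEquiv d).symm (fourierS d ψ) =
      𝓕 ψ := by
    ext x
    simp [fourierS]
  simp [inv, this]

namespace Represents

variable {d : ℕ} {f g : Sp d → ℂ} {T : 𝓢'(Sp d, ℂ)}

theorem congr (hf : Represents f T) (h : f =ᵐ[volume] g) : Represents g T := by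
  intro ψ
  have h' : (fun x => f x * ψ x) =ᵐ[volume] fun x => g x * ψ x := by
    filter_upwards [h] with x hx
    rw [hx]
  exact ⟨(hf ψ).1.congr h', (hf ψ).2.trans (integral_congr_ae h')⟩

theorem smulLeftCLM (hf : Represents f T) (hg : g.HasTemperateGrowth) :
    Represents (fun x => g x * f x) (TemperedDistribution.smulLeftCLM ℂ g T) := by
  intro ψ
  have h : (fun x => g x * f x * ψ x) =
      fun x => f x * SchwartzMap.smulLeftCLM ℂ g ψ x := by
    funext x
    rw [SchwartzMap.smulLeftCLM_apply_apply hg, smul_eq_mul]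
    ring
  rw [h, TemperedDistribution.smulLeftCLM_apply_apply]
  exact hf _

end Represents

/-- Surjectivity of the Fourier transform rules out the default value 0 in `invFourierOf`. -/
theorem represents_invFourierOf {d : ℕ} {f : Sp d → ℂ} {T : 𝓢'(Sp d, ℂ)} (hf : Represents f T) :
    Represents f (fourierD d (invFourierOf f)) := by
  obtain ⟨S, rfl⟩ := fourierD_surjective d T
  have h : ∃ S, Represents f (fourierD d S) := ⟨S, hf⟩
  rw [invFourierOf, dif_pos h]
  exact h.choose_spec

/-- A nonnegative measurable function of polynomial growth is a tempered distribution. -/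
theorem exists_represents {d : ℕ} {f : Sp d → ℝ} (hm : Measurable f) (h0 : ∀ x, 0 ≤ f x)
    {C : ℝ} {N : ℕ} (hb : ∀ x, f x ≤ C * (1 + ‖x‖) ^ N) :
    ∃ T : 𝓢'(Sp d, ℂ), Represents (fun x => (f x : ℂ)) T := by
  -- Nonnegativity allows f to be the density of a positive measure, and a measure of temperate
  -- growth is a tempered distribution.
  let w : Sp d → NNReal := fun x => (f x).toNNReal
  have hw : Measurable w := hm.real_toNNReal
  let μ : Measure (Sp d) := volume.withDensity fun x => (w x : ENNReal)
  have hws : ∀ x (z : ℂ), w x • z = (f x : ℂ) * z := by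
    intro x z
    rw [NNReal.smul_def, Real.coe_toNNReal _ (h0 x), Complex.real_smul]
  have hμ : μ.HasTemperateGrowth := by
    obtain ⟨n, hn⟩ := Measure.HasTemperateGrowth.exists_integrable (μ := (volume : Measure (Sp d)))
    -- The power N absorbs the growth of f, and n leaves an integrable weight.
    refine ⟨n + N, ?_⟩
    rw [integrable_withDensity_iff_integrable_smul hw]
    refine (hn.const_mul C).mono' (by fun_prop) (Filter.Eventually.of_forall fun x => ?_)
    have hx : (0 : ℝ) < 1 + ‖x‖ := by positivity
    rw [NNReal.smul_def, Real.coe_toNNReal _ (h0 x), smul_eq_mul, Real.rpow_neg hx.le,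
      Real.rpow_neg hx.le, Real.rpow_natCast, Real.rpow_natCast,
      Real.norm_of_nonneg (mul_nonneg (h0 x) (by positivity))]
    calc f x * ((1 + ‖x‖) ^ (n + N))⁻¹ ≤ C * (1 + ‖x‖) ^ N * ((1 + ‖x‖) ^ (n + N))⁻¹ := by
          gcongr
          exact hb x
      _ = C * ((1 + ‖x‖) ^ n)⁻¹ := by
          rw [pow_add]
          field_simp
  refine ⟨μ.toTemperedDistribution, fun ψ => ⟨?_, ?_⟩⟩
  · have h := ψ.integrable (μ := μ)
    rw [integrable_withDensity_iff_integrable_smul hw] at h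
    simpa only [hws] using h
  · rw [Measure.toTemperedDistribution_apply μ, integral_withDensity_eq_integral_smul hw]
    simp only [hws]

/-! ### The quadratic form -/

open Matrix in
theorem exists_norm_mulVec_le {d : ℕ} (M : Matrix (Fin d) (Fin d) ℝ) :
    ∃ C : ℝ, 0 < C ∧ ∀ x, ‖M *ᵥ x‖ ≤ C * ‖x‖ := by
  refine ⟨‖(Matrix.toLin' M).toContinuousLinearMap‖ + 1, by positivity, fun x => ?_⟩
  have h := (Matrix.toLin' M).toContinuousLinearMap.le_opNorm x
  simp only [LinearMap.coe_toContinuousLinearMap', Matrix.toLin'_apply] at h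
  nlinarith [norm_nonneg x]

/-- Symmetry of Q² folds the lower triangle onto the upper one, so that P can be compared with G
term by term. -/
theorem quadForm_eq_sum {d : ℕ} {Q : Matrix (Fin d) (Fin d) ℝ} (hQ : Q.IsHermitian)
    (x : Fin d → ℝ) :
    quadForm Q x = ∑ i, (Q * Q) i i * x i ^ 2 +
      2 * ∑ i, ∑ j ∈ Finset.Ioi i, (Q * Q) i j * (x i * x j) := by
  have hsymm : ∀ i j, (Q * Q) i j = (Q * Q) j i := by
    intro i j
    have hQ' : ∀ i j, Q j i = Q i j := fun i j => by simpa using hQ.apply i j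
    simp only [Matrix.mul_apply]
    refine Finset.sum_congr rfl fun k _ => ?_
    rw [hQ' k i, hQ' j k, mul_comm]
  set q := Q * Q
  have h1 : quadForm Q x = ∑ i, ∑ j, q i j * (x i * x j) := by
    simp only [quadForm, dotProduct, Matrix.mulVec, Finset.mul_sum]
    refine Finset.sum_congr rfl fun i _ => Finset.sum_congr rfl fun j _ => ?_
    ring
  have h2 : ∀ i, ∑ j, q i j * (x i * x j) = q i i * x i ^ 2 +
      ∑ j ∈ Finset.Ioi i, q i j * (x i * x j) + ∑ j ∈ Finset.Iio i, q i j * (x i * x j) := by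
    intro i
    have hu : (Finset.univ : Finset (Fin d)) = insert i (Finset.Ioi i ∪ Finset.Iio i) := by
      ext j
      simp only [Finset.mem_univ, Finset.mem_insert, Finset.mem_union, Finset.mem_Ioi,
        Finset.mem_Iio, true_iff]
      omega
    rw [hu, Finset.sum_insert (by simp), Finset.sum_union]
    · ring
    · rw [Finset.disjoint_left]
      intro j hj hj'
      simp only [Finset.mem_Ioi, Finset.mem_Iio] at hj hj'
      omega
  have h3 : ∑ i, ∑ j ∈ Finset.Iio i, q i j * (x i * x j) =
      ∑ i, ∑ j ∈ Finset.Ioi i, q i j * (x i * x j) := by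
    rw [Finset.sum_comm' (t' := Finset.univ) (s' := fun j => Finset.Ioi j) (by simp)]
    refine Finset.sum_congr rfl fun i _ => Finset.sum_congr rfl fun j _ => ?_
    rw [hsymm, mul_comm (x j)]
  rw [h1, Finset.sum_congr rfl fun i _ => h2 i, Finset.sum_add_distrib, Finset.sum_add_distrib, h3]
  ring

open Matrix in
theorem quadForm_eq_sum_sq {d : ℕ} {Q : Matrix (Fin d) (Fin d) ℝ} (hQ : Q.IsHermitian)
    (x : Fin d → ℝ) : quadForm Q x = ∑ i, (Q *ᵥ x) i ^ 2 := by
  have hT : Qᵀ = Q := by simpa [Matrix.IsHermitian, Matrix.conjTranspose_eq_transpose_of_trivial]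
    using hQ
  rw [quadForm, ← Matrix.mulVec_mulVec, Matrix.dotProduct_mulVec, ← Matrix.mulVec_transpose, hT]
  simp only [dotProduct, sq]

/-- The norm `x ↦ (P x)^{1/2}`. -/
def quadNorm {d : ℕ} (Q : Matrix (Fin d) (Fin d) ℝ) (x : Fin d → ℝ) : ℝ :=
  Real.sqrt (quadForm Q x)

theorem quadNorm_nonneg {d : ℕ} (Q : Matrix (Fin d) (Fin d) ℝ) (x : Fin d → ℝ) :
    0 ≤ quadNorm Q x :=
  Real.sqrt_nonneg _

section PosDef

open Matrix

variable {d : ℕ} {Q : Matrix (Fin d) (Fin d) ℝ} (hQ : Q.PosDef)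

include hQ

theorem quadForm_nonneg (x : Fin d → ℝ) : 0 ≤ quadForm Q x := by
  rw [quadForm_eq_sum_sq hQ.1]
  positivity

theorem quadNorm_sq (x : Fin d → ℝ) : quadNorm Q x ^ 2 = quadForm Q x :=
  Real.sq_sqrt (quadForm_nonneg hQ x)

theorem exists_norm_le_quadNorm : ∃ c : ℝ, 0 < c ∧ ∀ x, ‖x‖ ≤ c * quadNorm Q x := by
  obtain ⟨c, hc, h⟩ := exists_norm_mulVec_le Q⁻¹
  refine ⟨c, hc, fun x => ?_⟩
  have hdet : IsUnit Q.det := (Matrix.isUnit_iff_isUnit_det Q).1 hQ.isUnit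
  have hx : Q⁻¹ *ᵥ (Q *ᵥ x) = x := by
    rw [Matrix.mulVec_mulVec, Matrix.nonsing_inv_mul _ hdet, Matrix.one_mulVec]
  calc ‖x‖ = ‖Q⁻¹ *ᵥ (Q *ᵥ x)‖ := by rw [hx]
    _ ≤ c * ‖Q *ᵥ x‖ := h _
    _ ≤ c * quadNorm Q x := by
      refine mul_le_mul_of_nonneg_left ?_ hc.le
      refine (pi_norm_le_iff_of_nonneg (quadNorm_nonneg Q x)).2 fun i => ?_
      rw [quadNorm, quadForm_eq_sum_sq hQ.1, Real.norm_eq_abs]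
      refine Real.abs_le_sqrt ?_
      exact Finset.single_le_sum (f := fun i => (Q *ᵥ x) i ^ 2) (fun j _ => sq_nonneg _)
        (Finset.mem_univ i)

theorem exists_quadNorm_le_norm : ∃ c : ℝ, 0 < c ∧ ∀ x, quadNorm Q x ≤ c * ‖x‖ := by
  obtain ⟨c, hc, h⟩ := exists_norm_mulVec_le Q
  refine ⟨(d + 1) * c, by positivity, fun x => ?_⟩
  refine Real.sqrt_le_iff.2 ⟨by positivity, ?_⟩
  rw [quadForm_eq_sum_sq hQ.1]
  calc ∑ i, (Q *ᵥ x) i ^ 2 ≤ ∑ _i : Fin d, (c * ‖x‖) ^ 2 := by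
        refine Finset.sum_le_sum fun i _ => ?_
        rw [← sq_abs]
        have := (norm_le_pi_norm (Q *ᵥ x) i).trans (h x)
        rw [Real.norm_eq_abs] at this
        gcongr
    _ = d * (c * ‖x‖) ^ 2 := by simp
    _ ≤ (d + 1) ^ 2 * (c * ‖x‖) ^ 2 := by
        gcongr
        nlinarith [Nat.cast_nonneg (α := ℝ) d]
    _ = ((d + 1) * c * ‖x‖) ^ 2 := by ring

theorem quadForm_eq_zero_iff {x : Fin d → ℝ} : quadForm Q x = 0 ↔ x = 0 := by
  refine ⟨fun h => ?_, fun h => by simp [h, quadForm]⟩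
  obtain ⟨c, -, hc⟩ := exists_norm_le_quadNorm hQ
  have := hc x
  rw [quadNorm, h, Real.sqrt_zero, mul_zero] at this
  exact norm_le_zero_iff.1 this

theorem mul_self_diag_pos (i : Fin d) : 0 < (Q * Q) i i := by
  have h : quadForm Q (Pi.single i 1) = (Q * Q) i i := by
    simp [quadForm, Matrix.col_apply]
  rw [← h]
  refine (quadForm_nonneg hQ _).lt_of_ne' fun h0 => ?_
  simpa using congrFun ((quadForm_eq_zero_iff hQ).1 h0) i

/-- Since QB = r UQ and P(x) = |Qx|², the orthogonal factor drops out. This is the only form in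
which the factorization of A^{-T} is used. -/
theorem quadNorm_mulVec_of_eq {B U : Matrix (Fin d) (Fin d) ℝ} {r : ℝ} (hr : 0 ≤ r)
    (hU : U ∈ Matrix.orthogonalGroup (Fin d) ℝ) (hB : B = r • (Q⁻¹ * U * Q)) (x : Fin d → ℝ) :
    quadNorm Q (B *ᵥ x) = r * quadNorm Q x := by
  have hdet : IsUnit Q.det := (Matrix.isUnit_iff_isUnit_det Q).1 hQ.isUnit
  have hUU : Uᵀ * U = 1 := by
    have := (Matrix.mem_unitaryGroup_iff').1 hU
    rwa [Matrix.star_eq_conjTranspose, Matrix.conjTranspose_eq_transpose_of_trivial] at this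
  have h1 : Q *ᵥ (B *ᵥ x) = r • (U *ᵥ (Q *ᵥ x)) := by
    rw [hB, Matrix.mulVec_mulVec, Matrix.mul_smul, Matrix.smul_mulVec, Matrix.mul_assoc,
      ← Matrix.mul_assoc Q, Matrix.mul_nonsing_inv _ hdet, Matrix.one_mul, Matrix.mulVec_mulVec]
  have h2 : ∀ y : Fin d → ℝ, ∑ i, (U *ᵥ y) i ^ 2 = ∑ i, y i ^ 2 := by
    intro y
    have : (U *ᵥ y) ⬝ᵥ (U *ᵥ y) = y ⬝ᵥ y := by
      rw [Matrix.dotProduct_mulVec, ← Matrix.mulVec_transpose, Matrix.mulVec_mulVec, hUU,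
        Matrix.one_mulVec]
    simpa only [dotProduct, ← sq] using this
  have h3 : quadForm Q (B *ᵥ x) = r ^ 2 * quadForm Q x := by
    rw [quadForm_eq_sum_sq hQ.1, quadForm_eq_sum_sq hQ.1, h1]
    simp only [Pi.smul_apply, smul_eq_mul, mul_pow, ← Finset.mul_sum, h2]
  rw [quadNorm, h3, Real.sqrt_mul (sq_nonneg r), Real.sqrt_sq hr, quadNorm]

/-! ### The trigonometric polynomial -/

/-- From 4 sin²(t/2) = sin² t + 4 sin⁴(t/2). Both summands on the right are nonnegative, which gives
the sign and the zeros of G at once. -/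
theorem trigPoly_eq (x : Fin d → ℝ) :
    trigPoly Q x = quadForm Q (fun i => Real.sin (x i)) +
      4 * ∑ i, (Q * Q) i i * Real.sin (x i / 2) ^ 4 := by
  rw [quadForm_eq_sum hQ.1, trigPoly]
  have h : ∀ i, 4 * ((Q * Q) i i * Real.sin (x i / 2) ^ 2) =
      (Q * Q) i i * Real.sin (x i) ^ 2 + 4 * ((Q * Q) i i * Real.sin (x i / 2) ^ 4) := by
    intro i
    have h1 : Real.sin (x i) = 2 * Real.sin (x i / 2) * Real.cos (x i / 2) := by
      rw [← Real.sin_two_mul]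
      ring_nf
    rw [h1, mul_pow, mul_pow, Real.cos_sq']
    ring
  rw [Finset.mul_sum, Finset.sum_congr rfl fun i _ => h i, Finset.sum_add_distrib,
    ← Finset.mul_sum]
  ring

theorem trigPoly_nonneg (x : Fin d → ℝ) : 0 ≤ trigPoly Q x := by
  rw [trigPoly_eq hQ]
  have := quadForm_nonneg hQ (fun i => Real.sin (x i))
  have h : 0 ≤ ∑ i, (Q * Q) i i * Real.sin (x i / 2) ^ 4 :=
    Finset.sum_nonneg fun i _ => mul_nonneg (mul_self_diag_pos hQ i).le (by positivity)
  linarith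

theorem trigPoly_eq_zero_iff {x : Fin d → ℝ} :
    trigPoly Q x = 0 ↔ ∃ n : Fin d → ℤ, x = fun i => 2 * Real.pi * n i := by
  constructor
  · intro h
    rw [trigPoly_eq hQ] at h
    have h1 := quadForm_nonneg hQ (fun i => Real.sin (x i))
    have h2 : ∀ i ∈ Finset.univ, 0 ≤ (Q * Q) i i * Real.sin (x i / 2) ^ 4 :=
      fun i _ => mul_nonneg (mul_self_diag_pos hQ i).le (by positivity)
    have h3 := Finset.sum_nonneg h2
    have h4 : ∑ i, (Q * Q) i i * Real.sin (x i / 2) ^ 4 = 0 := by linarith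
    rw [Finset.sum_eq_zero_iff_of_nonneg h2] at h4
    have h5 : ∀ i, ∃ n : ℤ, (n : ℝ) * Real.pi = x i / 2 := by
      intro i
      rw [← Real.sin_eq_zero_iff]
      have := h4 i (Finset.mem_univ i)
      simpa [(mul_self_diag_pos hQ i).ne'] using this
    choose n hn using h5
    refine ⟨n, funext fun i => ?_⟩
    linarith [hn i]
  · rintro ⟨n, rfl⟩
    have h1 : ∀ i, Real.sin (2 * Real.pi * n i / 2) = 0 := fun i =>
      Real.sin_eq_zero_iff.2 ⟨n i, by ring⟩
    have h2 : ∀ i, Real.sin (2 * Real.pi * n i) = 0 := fun i =>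
      Real.sin_eq_zero_iff.2 ⟨2 * n i, by push_cast; ring⟩
    simp [trigPoly, h1, h2]

omit hQ in
theorem exists_trigPoly_le (Q : Matrix (Fin d) (Fin d) ℝ) : ∃ C : ℝ, ∀ x, trigPoly Q x ≤ C := by
  refine ⟨4 * ∑ i, |(Q * Q) i i| + 2 * ∑ i, ∑ j ∈ Finset.Ioi i, |(Q * Q) i j|, fun x => ?_⟩
  unfold trigPoly
  gcongr with i _ i _ j _
  · refine (le_abs_self _).trans ?_
    rw [abs_mul, abs_pow, sq_abs]
    exact mul_le_of_le_one_right (abs_nonneg _) (Real.sin_sq_le_one _)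
  · refine (le_abs_self _).trans ?_
    rw [abs_mul, abs_mul]
    exact mul_le_of_le_one_right (abs_nonneg _)
      (mul_le_one₀ (Real.abs_sin_le_one _) (abs_nonneg _) (Real.abs_sin_le_one _))

omit hQ in
theorem contDiff_trigPoly (Q : Matrix (Fin d) (Fin d) ℝ) : ContDiff ℝ 1 (trigPoly Q) := by
  unfold trigPoly
  fun_prop

omit hQ in
theorem abs_sin_sub_self_le (t : ℝ) : |Real.sin t - t| ≤ 2 * t ^ 2 := by
  have hs := Real.abs_sin_le_abs (x := t)
  rcases le_or_gt |t| 1 with h | h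
  · have h1 := abs_le.1 (Real.sin_bound h)
    have h2 : |t| ^ 3 ≤ |t| ^ 2 := pow_le_pow_of_le_one (abs_nonneg _) h (by norm_num)
    have h3 : |t| ^ 4 ≤ |t| ^ 2 := pow_le_pow_of_le_one (abs_nonneg _) h (by norm_num)
    have h4 : |t ^ 3| ≤ t ^ 2 := by rwa [abs_pow, ← sq_abs t]
    rw [sq_abs] at h3
    have h5 := abs_le.1 h4
    rw [abs_le]
    constructor <;> nlinarith [h1.1, h1.2, sq_nonneg t]
  · have h1 : |Real.sin t - t| ≤ |Real.sin t| + |t| := abs_sub _ _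
    have h2 : |t| ≤ t ^ 2 := by
      rw [← sq_abs]
      nlinarith
    linarith

/-- Third order is what is needed: after division by P, which is of order two, G/P - 1 is still
bounded linearly in the norm. -/
theorem exists_abs_trigPoly_sub_quadForm_le :
    ∃ C : ℝ, 0 ≤ C ∧ ∀ x, |trigPoly Q x - quadForm Q x| ≤ C * ‖x‖ ^ 3 := by
  refine ⟨∑ i, |(Q * Q) i i| * 2 + 2 * ∑ i, ∑ j ∈ Finset.Ioi i, |(Q * Q) i j| * 4,
    by positivity, fun x => ?_⟩
  have hx : ∀ i, |x i| ≤ ‖x‖ := fun i => by simpa using norm_le_pi_norm x i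
  have h1 : ∀ i, |4 * Real.sin (x i / 2) ^ 2 - x i ^ 2| ≤ 2 * ‖x‖ ^ 3 := by
    intro i
    have ha := abs_sin_sub_self_le (x i / 2)
    have hb := Real.abs_sin_le_abs (x := x i / 2)
    have hc : |Real.sin (x i / 2) + x i / 2| ≤ ‖x‖ := by
      refine (abs_add_le _ _).trans ?_
      have : |x i / 2| = |x i| / 2 := by rw [abs_div, abs_two]
      linarith [hx i]
    have hd : 2 * (x i / 2) ^ 2 ≤ ‖x‖ ^ 2 / 2 := by
      have : x i ^ 2 ≤ ‖x‖ ^ 2 := by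
        rw [← sq_abs]
        gcongr
        exact hx i
      linarith
    calc |4 * Real.sin (x i / 2) ^ 2 - x i ^ 2|
        = 4 * (|Real.sin (x i / 2) - x i / 2| * |Real.sin (x i / 2) + x i / 2|) := by
          rw [← abs_mul, ← abs_of_pos (four_pos (α := ℝ)), ← abs_mul,
            abs_of_pos (four_pos (α := ℝ))]
          ring_nf
      _ ≤ 4 * (‖x‖ ^ 2 / 2 * ‖x‖) := by
          gcongr
          exact ha.trans hd
      _ = 2 * ‖x‖ ^ 3 := by ring
  have h2 : ∀ i j, |Real.sin (x i) * Real.sin (x j) - x i * x j| ≤ 4 * ‖x‖ ^ 3 := by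
    intro i j
    have hs : ∀ i, |Real.sin (x i) - x i| ≤ 2 * ‖x‖ ^ 2 := by
      intro i
      refine (abs_sin_sub_self_le (x i)).trans ?_
      rw [← sq_abs]
      gcongr
      exact hx i
    calc |Real.sin (x i) * Real.sin (x j) - x i * x j|
        = |(Real.sin (x i) - x i) * Real.sin (x j) + x i * (Real.sin (x j) - x j)| := by ring_nf
      _ ≤ |Real.sin (x i) - x i| * |Real.sin (x j)| + |x i| * |Real.sin (x j) - x j| := by
          rw [← abs_mul, ← abs_mul]
          exact abs_add_le _ _
      _ ≤ 2 * ‖x‖ ^ 2 * ‖x‖ + ‖x‖ * (2 * ‖x‖ ^ 2) := by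
          gcongr
          · exact hs i
          · exact Real.abs_sin_le_abs.trans (hx j)
          · exact hx i
          · exact hs j
      _ = 4 * ‖x‖ ^ 3 := by ring
  have h3 : trigPoly Q x - quadForm Q x =
      ∑ i, (Q * Q) i i * (4 * Real.sin (x i / 2) ^ 2 - x i ^ 2) +
      2 * ∑ i, ∑ j ∈ Finset.Ioi i, (Q * Q) i j * (Real.sin (x i) * Real.sin (x j) - x i * x j) := by
    rw [quadForm_eq_sum hQ.1, trigPoly]
    simp only [mul_sub, Finset.sum_sub_distrib, Finset.mul_sum]
    have : ∀ i, 4 * ((Q * Q) i i * Real.sin (x i / 2) ^ 2) =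
      (Q * Q) i i * (4 * Real.sin (x i / 2) ^ 2) := fun i => by ring
    simp only [this]
    ring
  rw [h3, add_mul, Finset.sum_mul, mul_assoc, Finset.sum_mul]
  refine (abs_add_le _ _).trans (add_le_add ?_ ?_)
  · refine (Finset.abs_sum_le_sum_abs _ _).trans (Finset.sum_le_sum fun i _ => ?_)
    rw [abs_mul, mul_assoc]
    exact mul_le_mul_of_nonneg_left (h1 i) (abs_nonneg _)
  · rw [abs_mul, abs_two]
    refine mul_le_mul_of_nonneg_left ?_ zero_le_two
    refine (Finset.abs_sum_le_sum_abs _ _).trans (Finset.sum_le_sum fun i _ => ?_)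
    rw [Finset.sum_mul]
    refine (Finset.abs_sum_le_sum_abs _ _).trans (Finset.sum_le_sum fun j _ => ?_)
    rw [abs_mul, mul_assoc]
    exact mul_le_mul_of_nonneg_left (h2 i j) (abs_nonneg _)

end PosDef

/-! ### The dilation matrix and the mask -/

section Dilation

open Matrix

variable {d : ℕ} {A : Matrix (Fin d) (Fin d) ℤ}

/-- The determinant is the product of the eigenvalues, a nonempty product because d > 0. -/
theorem one_lt_absDet (hd : 0 < d) (hA : IsDilation A) : 1 < absDet A := by
  have key : ∀ s : Multiset ℂ, (∀ z ∈ s, 1 < ‖z‖) → s ≠ 0 → 1 < ‖s.prod‖ := by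
    intro s
    induction s using Multiset.induction with
    | empty => simp
    | cons a s ih =>
      intro h _
      have ha := h a (Multiset.mem_cons_self a s)
      rw [Multiset.prod_cons, norm_mul]
      rcases eq_or_ne s 0 with rfl | hs
      · simpa using ha
      · have := ih (fun z hz => h z (Multiset.mem_cons_of_mem hz)) hs
        nlinarith
  have hdet : (A.map (fun n : ℤ => (n : ℂ))).det = (A.det : ℂ) := by
    have := (Int.castRingHom ℂ).map_det A
    simpa using this.symm
  have h := key (A.map (fun n : ℤ => (n : ℂ))).charpoly.roots ?_ ?_
  · rw [← Matrix.det_eq_prod_roots_charpoly, hdet, Complex.norm_intCast] at h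
    exact h
  · intro z hz
    refine hA z ?_
    rw [Matrix.mem_spectrum_iff_isRoot_charpoly]
    exact Polynomial.isRoot_of_mem_roots hz
  · intro h0
    have h1 := IsAlgClosed.card_roots_eq_natDegree
      (p := (A.map (fun n : ℤ => (n : ℂ))).charpoly)
    rw [h0, Matrix.charpoly_natDegree_eq_dim] at h1
    simp at h1
    omega

theorem isUnit_det_realMat_transpose (hA : 1 < absDet A) : IsUnit (realMat A)ᵀ.det := by
  have h : (realMat A).det = (A.det : ℝ) := by
    have := (Int.castRingHom ℝ).map_det A
    simpa [realMat] using this.symm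
  rw [Matrix.det_transpose, h, isUnit_iff_ne_zero]
  intro h0
  rw [absDet, h0, abs_zero] at hA
  linarith

theorem realMat_mulVec_invTr (hA : 1 < absDet A) (x : Fin d → ℝ) :
    (realMat A)ᵀ *ᵥ (invTr A *ᵥ x) = x := by
  rw [invTr, Matrix.mulVec_mulVec, Matrix.mul_nonsing_inv _ (isUnit_det_realMat_transpose hA),
    Matrix.one_mulVec]

theorem invTr_mulVec_realMat (hA : 1 < absDet A) (x : Fin d → ℝ) :
    invTr A *ᵥ ((realMat A)ᵀ *ᵥ x) = x := by
  rw [invTr, Matrix.mulVec_mulVec, Matrix.nonsing_inv_mul _ (isUnit_det_realMat_transpose hA),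
    Matrix.one_mulVec]

/-- A digit s is recovered from the integer vector Aᵀs, which stays in a bounded box. Finiteness
turns the `finprod` in the mask into an honest product. -/
theorem finite_digitPoints (hA : 1 < absDet A) : (digitPoints A).Finite := by
  obtain ⟨C, hC, hCb⟩ := exists_norm_mulVec_le (realMat A)ᵀ
  have hfin : (Set.Icc (fun _ : Fin d => -⌈C⌉) (fun _ => ⌈C⌉)).Finite := Set.finite_Icc _ _
  refine (hfin.image fun n : Fin d → ℤ => invTr A *ᵥ fun i => (n i : ℝ)).subset ?_
  rintro s ⟨hs, n, hn⟩
  refine ⟨n, ?_, ?_⟩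
  · have hs1 : ‖s‖ ≤ 1 := (pi_norm_le_iff_of_nonneg zero_le_one).2 fun i => by
      rw [Real.norm_eq_abs, abs_of_nonneg (hs i).1]
      exact (hs i).2.le
    have h1 : ∀ i, |(n i : ℝ)| ≤ ⌈C⌉ := by
      intro i
      have h2 := (norm_le_pi_norm ((realMat A)ᵀ *ᵥ s) i).trans (hCb s)
      rw [hn, Real.norm_eq_abs] at h2
      have h3 := Int.le_ceil C
      nlinarith
    have h2 : ∀ i, -⌈C⌉ ≤ n i ∧ n i ≤ ⌈C⌉ := fun i => by
      have := abs_le.1 (h1 i)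
      exact ⟨by exact_mod_cast this.1, by exact_mod_cast this.2⟩
    exact ⟨fun i => (h2 i).1, fun i => (h2 i).2⟩
  · change invTr A *ᵥ (fun i => (n i : ℝ)) = s
    rw [← hn, invTr_mulVec_realMat hA]

variable {Q : Matrix (Fin d) (Fin d) ℝ}

theorem mask_eq (hA : 1 < absDet A) (x : Fin d → ℝ) :
    mask A Q x =
      (∏ s ∈ ((finite_digitPoints hA).sdiff (t := {0})).toFinset,
        trigPoly Q (x + (2 * Real.pi) • s)) /
      ∏ s ∈ ((finite_digitPoints hA).sdiff (t := {0})).toFinset,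
        trigPoly Q ((2 * Real.pi) • s) := by
  rw [mask, finprod_mem_eq_finite_toFinset_prod _ ((finite_digitPoints hA).sdiff (t := {0})),
    finprod_mem_eq_finite_toFinset_prod _ ((finite_digitPoints hA).sdiff (t := {0}))]

theorem mask_nonneg (hQ : Q.PosDef) (hA : 1 < absDet A) (x : Fin d → ℝ) : 0 ≤ mask A Q x := by
  rw [mask_eq hA]
  exact div_nonneg (Finset.prod_nonneg fun s _ => trigPoly_nonneg hQ _)
    (Finset.prod_nonneg fun s _ => trigPoly_nonneg hQ _)

/-- The point is that the normalizing denominator is nonzero: G(2πs) = 0 would make s an integer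
vector, and the only one in [0,1)^d is 0. -/
theorem mask_zero (hQ : Q.PosDef) (hA : 1 < absDet A) : mask A Q 0 = 1 := by
  rw [mask_eq hA]
  simp only [zero_add]
  refine div_self (Finset.prod_ne_zero_iff.2 fun s hs => ?_)
  rw [Set.Finite.mem_toFinset] at hs
  intro h0
  obtain ⟨n, hn⟩ := (trigPoly_eq_zero_iff hQ).1 h0
  refine hs.2 (funext fun i => ?_)
  have hi : s i = n i := by
    have := congrFun hn i
    simp only [Pi.smul_apply, smul_eq_mul] at this
    exact mul_left_cancel₀ (by positivity) this
  have h1 := hs.1.1 i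
  rw [hi] at h1
  have h2 : (0 : ℤ) ≤ n i := by exact_mod_cast h1.1
  have h3 : n i < 1 := by exact_mod_cast h1.2
  have h4 : n i = 0 := by omega
  rw [hi, h4]
  simp

theorem exists_mask_le (hQ : Q.PosDef) (hA : 1 < absDet A) :
    ∃ K : ℝ, 1 ≤ K ∧ ∀ x, mask A Q x ≤ K := by
  obtain ⟨C, hC⟩ := exists_trigPoly_le Q
  refine ⟨_, le_max_left 1 (C ^ ((finite_digitPoints hA).sdiff (t := {0})).toFinset.card /
    ∏ s ∈ ((finite_digitPoints hA).sdiff (t := {0})).toFinset,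
        trigPoly Q ((2 * Real.pi) • s)), fun x => le_max_of_le_right ?_⟩
  rw [mask_eq hA]
  refine div_le_div_of_nonneg_right ?_ (Finset.prod_nonneg fun s _ => trigPoly_nonneg hQ _)
  rw [← Finset.prod_const]
  exact Finset.prod_le_prod (fun s _ => trigPoly_nonneg hQ _) fun s _ => hC _

theorem differentiable_mask (hA : 1 < absDet A) : Differentiable ℝ (mask A Q) := by
  have h : mask A Q = fun x => _ := funext (mask_eq hA)
  rw [h]
  refine ContDiff.differentiable (n := 1) ?_ one_ne_zero
  refine (contDiff_prod fun s _ => ?_).div_const _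
  exact (contDiff_trigPoly Q).comp (contDiff_id.add contDiff_const)

/-- Differentiability at 0 gives the bound near the origin, boundedness of m₀ gives it elsewhere. It
is stated with `quadNorm` because that norm decays geometrically along orbits of A^{-T}. -/
theorem exists_abs_mask_sub_one_le (hQ : Q.PosDef) (hA : 1 < absDet A) :
    ∃ C : ℝ, 0 ≤ C ∧ ∀ x, |mask A Q x - 1| ≤ C * quadNorm Q x := by
  obtain ⟨K, hK1, hK⟩ := exists_mask_le hQ hA
  obtain ⟨c, hc, hcb⟩ := exists_norm_le_quadNorm hQ
  obtain ⟨C, hC⟩ := ((differentiable_mask (Q := Q) hA) 0).isBigO_sub.bound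
  obtain ⟨δ, hδ, hδb⟩ := Metric.eventually_nhds_iff.1 hC
  have key : ∀ x, |mask A Q x - 1| ≤ max C (K / δ) * ‖x‖ := by
    intro x
    rcases lt_or_ge ‖x‖ δ with h | h
    · have := hδb (y := x) (by simpa using h)
      rw [mask_zero hQ hA, sub_zero, Real.norm_eq_abs] at this
      exact this.trans (by gcongr; exact le_max_left _ _)
    · have h1 : |mask A Q x - 1| ≤ K := by
        rw [abs_le]
        constructor <;> linarith [hK x, mask_nonneg hQ hA x]
      calc |mask A Q x - 1| ≤ K / δ * δ := by rwa [div_mul_cancel₀ _ hδ.ne']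
        _ ≤ max C (K / δ) * ‖x‖ := by
          have : 0 ≤ K / δ := by positivity
          gcongr
          exact le_max_right _ _
  have h0 : 0 ≤ max C (K / δ) := le_max_of_le_right (by positivity)
  refine ⟨max C (K / δ) * c, by positivity, fun x => (key x).trans ?_⟩
  rw [mul_assoc]
  gcongr
  exact hcb x

/-- Aᵀ maps 2πℤ^d into itself. Hence an orbit of A^{-T} starting off the zeros of G never meets
them, and the default value of `mu` plays no role there. -/
theorem trigPoly_eq_zero_of_invTr (hQ : Q.PosDef) (hA : 1 < absDet A) {x : Fin d → ℝ}
    (h : trigPoly Q (invTr A *ᵥ x) = 0) : trigPoly Q x = 0 := by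
  obtain ⟨n, hn⟩ := (trigPoly_eq_zero_iff hQ).1 h
  refine (trigPoly_eq_zero_iff hQ).2 ⟨Aᵀ *ᵥ n, ?_⟩
  rw [← realMat_mulVec_invTr hA x, hn]
  funext i
  simp only [Matrix.mulVec, dotProduct, realMat, Matrix.transpose_apply, Matrix.map_apply]
  push_cast
  rw [Finset.mul_sum]
  exact Finset.sum_congr rfl fun j _ => by ring

/-! ### The infinite products -/

theorem invTr_pow_succ_mulVec (j : ℕ) (x : Fin d → ℝ) :
    invTr A ^ (j + 1) *ᵥ x = invTr A ^ j *ᵥ (invTr A *ᵥ x) := by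
  rw [pow_succ, Matrix.mulVec_mulVec]

theorem invTr_pow_succ_mulVec' (j : ℕ) (x : Fin d → ℝ) :
    invTr A ^ (j + 1) *ᵥ x = invTr A *ᵥ (invTr A ^ j *ᵥ x) := by
  rw [pow_succ', Matrix.mulVec_mulVec]

theorem trigPoly_invTr_pow_ne_zero (hQ : Q.PosDef) (hA : 1 < absDet A) {x : Fin d → ℝ}
    (h : trigPoly Q x ≠ 0) (j : ℕ) : trigPoly Q (invTr A ^ j *ᵥ x) ≠ 0 := by
  induction j with
  | zero => simpa using h
  | succ j ih =>
    rw [invTr_pow_succ_mulVec']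
    exact fun h0 => ih (trigPoly_eq_zero_of_invTr hQ hA h0)

variable (hQ : Q.PosDef) (hA : 1 < absDet A) {r : ℝ} (hr0 : 0 < r) (hr1 : r < 1)
  (hB : ∀ x, quadNorm Q (invTr A *ᵥ x) = r * quadNorm Q x)

include hB in
theorem quadNorm_invTr_pow (j : ℕ) (x : Fin d → ℝ) :
    quadNorm Q (invTr A ^ j *ᵥ x) = r ^ j * quadNorm Q x := by
  induction j with
  | zero => simp
  | succ j ih => rw [invTr_pow_succ_mulVec', hB, ih, pow_succ]; ring

include hr0 hr1 hB in
/-- Along the orbits of `A^{-T}`, a function that is Lipschitz at the origin is summable. -/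
theorem summable_invTr_pow {f : (Fin d → ℝ) → ℝ} {C : ℝ} {x : Fin d → ℝ}
    (hf : ∀ j : ℕ, |f (invTr A ^ j *ᵥ x)| ≤ C * quadNorm Q (invTr A ^ j *ᵥ x)) :
    Summable fun j : ℕ => f (invTr A ^ j *ᵥ x) := by
  refine Summable.of_norm_bounded
    ((summable_geometric_of_lt_one hr0.le hr1).mul_left (C * quadNorm Q x)) fun j => ?_
  rw [Real.norm_eq_abs]
  refine (hf j).trans_eq ?_
  rw [quadNorm_invTr_pow hB]
  ring

include hQ hA hr0 hr1 hB

theorem multipliable_mask (x : Fin d → ℝ) :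
    Multipliable fun j : ℕ => mask A Q (invTr A ^ (j + 1) *ᵥ x) := by
  obtain ⟨C, -, hC⟩ := exists_abs_mask_sub_one_le hQ hA
  have h := summable_invTr_pow (x := invTr A *ᵥ x) (f := fun y => mask A Q y - 1) hr0 hr1 hB
    fun j => hC _
  simpa only [add_sub_cancel, invTr_pow_succ_mulVec] using Real.multipliable_one_add_of_summable h

theorem tendsto_phiHat (x : Fin d → ℝ) :
    Filter.Tendsto (fun n => ∏ j ∈ Finset.range n, mask A Q (invTr A ^ (j + 1) *ᵥ x))
      Filter.atTop (nhds (phiHat A Q x)) :=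
  (multipliable_mask hQ hA hr0 hr1 hB x).hasProd.tendsto_prod_nat

theorem phiHat_nonneg (x : Fin d → ℝ) : 0 ≤ phiHat A Q x :=
  ge_of_tendsto' (tendsto_phiHat hQ hA hr0 hr1 hB x) fun _ =>
    Finset.prod_nonneg fun _ _ => mask_nonneg hQ hA _

theorem measurable_phiHat : Measurable (phiHat A Q) := by
  refine measurable_of_tendsto_metrizable (fun n => ?_)
    (tendsto_pi_nhds.2 (tendsto_phiHat hQ hA hr0 hr1 hB))
  refine Continuous.measurable ?_
  refine continuous_finsetProd _ fun j _ => ?_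
  exact (differentiable_mask hA).continuous.comp (continuous_const.matrix_mulVec continuous_id)

theorem phiHat_eq_mask_mul (x : Fin d → ℝ) :
    phiHat A Q x = mask A Q (invTr A *ᵥ x) * phiHat A Q (invTr A *ᵥ x) := by
  have h := multipliable_mask hQ hA hr0 hr1 hB (invTr A *ᵥ x)
  simp only [← invTr_pow_succ_mulVec] at h
  have h' := tprod_eq_zero_mul' (f := fun j : ℕ => mask A Q (invTr A ^ (j + 1) *ᵥ x)) h
  rw [phiHat, h', zero_add, pow_one]
  congr 1
  exact tprod_congr fun j => by rw [invTr_pow_succ_mulVec]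

/-- The factor of index j is at most 1 + C r^j ≤ exp(C r^j), and the exponents form a geometric
series. -/
theorem exists_phiHat_le_of_quadNorm_le_one :
    ∃ C : ℝ, 0 < C ∧ ∀ x, quadNorm Q x ≤ 1 → phiHat A Q x ≤ C := by
  obtain ⟨C, hC0, hC⟩ := exists_abs_mask_sub_one_le hQ hA
  refine ⟨Real.exp (C * (1 - r)⁻¹), Real.exp_pos _, fun x hx => ?_⟩
  refine le_of_tendsto' (tendsto_phiHat hQ hA hr0 hr1 hB x) fun n => ?_
  have hs := summable_geometric_of_lt_one hr0.le hr1
  calc ∏ j ∈ Finset.range n, mask A Q (invTr A ^ (j + 1) *ᵥ x)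
      ≤ ∏ j ∈ Finset.range n, Real.exp (C * r ^ j) := by
        refine Finset.prod_le_prod (fun j _ => mask_nonneg hQ hA _) fun j _ => ?_
        have h1 := (le_abs_self _).trans (hC (invTr A ^ (j + 1) *ᵥ x))
        have h2 : quadNorm Q (invTr A ^ (j + 1) *ᵥ x) ≤ r ^ j := by
          rw [quadNorm_invTr_pow hB, pow_succ, mul_assoc]
          refine mul_le_of_le_one_right (by positivity) ?_
          exact mul_le_one₀ hr1.le (quadNorm_nonneg Q x) hx
        have h3 := mul_le_mul_of_nonneg_left h2 hC0
        linarith [Real.add_one_le_exp (C * r ^ j)]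
    _ = Real.exp (C * ∑ j ∈ Finset.range n, r ^ j) := by
        rw [← Real.exp_sum, Finset.mul_sum]
    _ ≤ Real.exp (C * (1 - r)⁻¹) := by
        rw [← tsum_geometric_of_lt_one hr0.le hr1]
        gcongr
        exact hs.sum_le_tsum _ fun j _ => by positivity

/-- Each application of φ^(x) = m₀(Bx) φ^(Bx), with B = A^{-T}, costs a factor K and shrinks the
norm by r. With K < r^{-N} the cost is covered by the growth of an N-th power. -/
theorem exists_phiHat_le :
    ∃ (C : ℝ) (N : ℕ), 0 < C ∧ ∀ x, phiHat A Q x ≤ C * (1 + ‖x‖) ^ N := by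
  obtain ⟨C, hC0, hC⟩ := exists_phiHat_le_of_quadNorm_le_one hQ hA hr0 hr1 hB
  obtain ⟨K, hK1, hK⟩ := exists_mask_le hQ hA
  obtain ⟨c, hc0, hc⟩ := exists_quadNorm_le_norm hQ
  obtain ⟨N, hN⟩ := pow_unbounded_of_one_lt K ((one_lt_inv₀ hr0).2 hr1)
  -- Induction on the number of steps that suffice to enter the unit ball. The factor r⁻¹ makes the
  -- bound at Bx equal to C |x|^N when |x| > 1, in the norm `quadNorm`, so that the inductive step
  -- closes.
  have key : ∀ (n : ℕ) (x : Fin d → ℝ), r ^ n * quadNorm Q x ≤ 1 →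
      phiHat A Q x ≤ C * max 1 (r⁻¹ * quadNorm Q x) ^ N := by
    intro n
    induction n with
    | zero =>
      intro x hx
      rw [pow_zero, one_mul] at hx
      refine (hC x hx).trans (le_mul_of_one_le_right hC0.le ?_)
      exact one_le_pow₀ (le_max_left _ _)
    | succ n ih =>
      intro x hx
      rcases le_or_gt (quadNorm Q x) 1 with h1 | h1
      · refine (hC x h1).trans (le_mul_of_one_le_right hC0.le ?_)
        exact one_le_pow₀ (le_max_left _ _)
      · have h2 := ih (invTr A *ᵥ x) (by rw [hB]; rwa [pow_succ, mul_assoc] at hx)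
        rw [hB, inv_mul_cancel_left₀ hr0.ne', max_eq_right h1.le] at h2
        have h3 := quadNorm_nonneg Q x
        rw [phiHat_eq_mask_mul hQ hA hr0 hr1 hB]
        calc mask A Q (invTr A *ᵥ x) * phiHat A Q (invTr A *ᵥ x)
            ≤ r⁻¹ ^ N * (C * quadNorm Q x ^ N) :=
              mul_le_mul ((hK _).trans hN.le) h2 (phiHat_nonneg hQ hA hr0 hr1 hB _) (by positivity)
          _ = C * (r⁻¹ * quadNorm Q x) ^ N := by ring
          _ ≤ C * max 1 (r⁻¹ * quadNorm Q x) ^ N := by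
              gcongr
              exact le_max_right _ _
  refine ⟨C * (max 1 (r⁻¹ * c)) ^ N, N, by positivity, fun x => ?_⟩
  obtain ⟨n, hn⟩ := (((tendsto_pow_atTop_nhds_zero_of_lt_one hr0.le hr1).mul_const
    (quadNorm Q x)).eventually_le_const (show 0 * quadNorm Q x < 1 by simp)).exists
  refine (key n x hn).trans ?_
  rw [mul_assoc, ← mul_pow]
  gcongr
  refine max_le (one_le_mul_of_one_le_of_one_le (le_max_left _ _) (by simp)) ?_
  calc r⁻¹ * quadNorm Q x ≤ r⁻¹ * (c * ‖x‖) := by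
        gcongr
        exact hc x
    _ = r⁻¹ * c * ‖x‖ := by ring
    _ ≤ max 1 (r⁻¹ * c) * (1 + ‖x‖) := by
        gcongr
        · exact le_max_right _ _
        · simp

/-- Away from the zeros of `G`, the identity `M = φ^ P / G` holds. -/
theorem bigM_eq (hrq : absDet A ^ ((2 : ℝ) / (d : ℝ)) * r ^ 2 = 1) {x : Fin d → ℝ}
    (hx : trigPoly Q x ≠ 0) :
    bigM A Q x = phiHat A Q x * (quadForm Q x / trigPoly Q x) := by
  have hx0 : x ≠ 0 := by
    rintro rfl
    exact hx ((trigPoly_eq_zero_iff hQ).2 ⟨0, by ext; simp⟩)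
  have hn : ∀ j : ℕ, 0 < quadNorm Q (invTr A ^ j *ᵥ x) := by
    intro j
    have h1 : 0 < quadNorm Q x := by
      refine (quadNorm_nonneg Q x).lt_of_ne' fun h => hx0 ((quadForm_eq_zero_iff hQ).1 ?_)
      rw [← quadNorm_sq hQ, h]
      simp
    rw [quadNorm_invTr_pow hB]
    positivity
  have hP : ∀ j : ℕ, 0 < quadForm Q (invTr A ^ j *ᵥ x) := fun j => by
    rw [← quadNorm_sq hQ]
    exact pow_pos (hn j) 2
  have hG := trigPoly_invTr_pow_ne_zero hQ hA hx
  let R : (Fin d → ℝ) → ℝ := fun y => trigPoly Q y / quadForm Q y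
  have hR0 : ∀ j : ℕ, 0 < R (invTr A ^ j *ᵥ x) := fun j =>
    div_pos ((trigPoly_nonneg hQ _).lt_of_ne' (hG j)) (hP j)
  have hRs : Summable fun j : ℕ => R (invTr A ^ j *ᵥ x) - 1 := by
    obtain ⟨C, hC0, hC⟩ := exists_abs_trigPoly_sub_quadForm_le hQ
    obtain ⟨c, hc0, hc⟩ := exists_norm_le_quadNorm hQ
    refine summable_invTr_pow (f := fun y => R y - 1) (C := C * c ^ 3) hr0 hr1 hB fun j => ?_
    set y := invTr A ^ j *ᵥ x
    have hPy : 0 < quadForm Q y := hP j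
    have h1 : R y - 1 = (trigPoly Q y - quadForm Q y) / quadForm Q y := by
      rw [sub_div, div_self hPy.ne']
    rw [h1, abs_div, abs_of_pos hPy, div_le_iff₀ hPy]
    calc |trigPoly Q y - quadForm Q y| ≤ C * ‖y‖ ^ 3 := hC y
      _ ≤ C * (c * quadNorm Q y) ^ 3 := by
          gcongr
          exact hc y
      _ = C * c ^ 3 * quadNorm Q y * quadForm Q y := by
          rw [← quadNorm_sq hQ]
          ring
  have hRlim : Filter.Tendsto (fun j : ℕ => R (invTr A ^ j *ᵥ x)) Filter.atTop (nhds 1) := by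
    simpa using hRs.tendsto_atTop_zero.add_const 1
  -- The product of the first n quotients telescopes to R(Bⁿx)/R(x), where B = A^{-T}, and tends to
  -- 1/R(x) = P(x)/G(x).
  let g : ℕ → ℝ := fun j => R (invTr A ^ (j + 1) *ᵥ x) / R (invTr A ^ j *ᵥ x)
  have hgm : Multipliable g := by
    have hgs : Summable fun j => g j - 1 := by
      -- The constant 2 bounds 1/R along the orbit, since eventually R ≥ 1/2.
      have h1 := (((summable_nat_add_iff 1).2 hRs).sub hRs).norm.mul_left 2
      refine h1.of_norm_bounded_eventually ?_
      rw [Nat.cofinite_eq_atTop]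
      filter_upwards [hRlim.eventually_const_le (show (1 / 2 : ℝ) < 1 by norm_num)] with j hj
      have h2 : g j - 1 = (R (invTr A ^ (j + 1) *ᵥ x) - R (invTr A ^ j *ᵥ x)) /
          R (invTr A ^ j *ᵥ x) := by
        rw [sub_div, div_self (hR0 j).ne']
      rw [h2, sub_sub_sub_cancel_right, norm_div, Real.norm_of_nonneg (hR0 j).le,
        div_le_iff₀ (hR0 j)]
      nlinarith [norm_nonneg (R (invTr A ^ (j + 1) *ᵥ x) - R (invTr A ^ j *ᵥ x))]
    simpa using Real.multipliable_one_add_of_summable hgs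
  have hgp : ∏' j, g j = quadForm Q x / trigPoly Q x := by
    have h1 : ∀ n, ∏ j ∈ Finset.range n, g j = R (invTr A ^ n *ᵥ x) / R x := by
      intro n
      induction n with
      | zero => simpa using (div_self (by simpa using (hR0 0).ne')).symm
      | succ n ih =>
        rw [Finset.prod_range_succ, ih, mul_comm, div_mul_div_cancel₀ (hR0 n).ne']
    refine tendsto_nhds_unique hgm.hasProd.tendsto_prod_nat ?_
    simp only [h1]
    simpa only [R, one_div_div] using hRlim.div_const (R x)
  have hmu : ∀ j : ℕ, mu A Q (invTr A ^ j *ᵥ x) = mask A Q (invTr A ^ (j + 1) *ᵥ x) * g j := by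
    intro j
    rw [mu, if_neg (hG j)]
    simp only [g, R, ← invTr_pow_succ_mulVec']
    have h1 : quadForm Q (invTr A ^ (j + 1) *ᵥ x) = r ^ 2 * quadForm Q (invTr A ^ j *ᵥ x) := by
      rw [← quadNorm_sq hQ, ← quadNorm_sq hQ, invTr_pow_succ_mulVec', hB]
      ring
    rw [h1]
    -- The factor q^{2/d} in μ exactly undoes the scaling of P by r² under A^{-T}.
    have h2 : absDet A ^ ((2 : ℝ) / (d : ℝ)) = (r ^ 2)⁻¹ := eq_inv_of_mul_eq_one_left hrq
    have h3 := hG j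
    have h4 := (hP j).ne'
    rw [h2]
    field_simp
  rw [bigM, ← hgp, phiHat, ← (multipliable_mask hQ hA hr0 hr1 hB x).tprod_mul hgm]
  exact tprod_congr hmu

/-- The pointwise identity behind `Δ^♯ φ^{m+1} = 𝒢 φ^m`. -/
theorem quadForm_div_bigM_mul_phiHat_pow
    (hrq : absDet A ^ ((2 : ℝ) / (d : ℝ)) * r ^ 2 = 1) {x : Fin d → ℝ}
    (hx : trigPoly Q x ≠ 0) {m : ℕ} (hm : m ≠ 0) :
    quadForm Q x / bigM A Q x * phiHat A Q x ^ (m + 1) = trigPoly Q x * phiHat A Q x ^ m := by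
  have hP : quadForm Q x ≠ 0 := by
    rw [Ne, quadForm_eq_zero_iff hQ]
    rintro rfl
    exact hx ((trigPoly_eq_zero_iff hQ).2 ⟨0, by ext; simp⟩)
  rw [bigM_eq hQ hA hr0 hr1 hB hrq hx]
  -- If φ^(x) = 0 then M(x) = 0 and the quotient P/M takes the value 0; the right side vanishes too,
  -- because m ≠ 0.
  rcases eq_or_ne (phiHat A Q x) 0 with h0 | h0
  · simp [h0, hm]
  · rw [pow_succ]
    field_simp

end Dilation

/-! ### The scaling functions -/

/-- The zeros are countable, and Lebesgue measure has no atoms once d > 0. -/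
theorem ae_trigPoly_ne_zero {d : ℕ} (hd : 0 < d) {Q : Matrix (Fin d) (Fin d) ℝ} (hQ : Q.PosDef) :
    ∀ᵐ ξ : Sp d, trigPoly Q (fun i => ξ i) ≠ 0 := by
  have : Nonempty (Fin d) := ⟨⟨0, hd⟩⟩
  refine measure_mono_null (t := Set.range fun n : Fin d → ℤ =>
    (WithLp.toLp 2 fun i => 2 * Real.pi * n i : Sp d)) ?_
    ((Set.countable_range _).measure_zero volume)
  intro ξ hξ
  simp only [ne_eq, Set.mem_compl_iff, Set.mem_ofPred_eq, not_not] at hξ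
  obtain ⟨n, hn⟩ := (trigPoly_eq_zero_iff hQ).1 hξ
  refine ⟨n, ?_⟩
  ext i
  exact (congrFun hn i).symm

theorem represents_phi {d : ℕ} {A : Matrix (Fin d) (Fin d) ℤ} {Q : Matrix (Fin d) (Fin d) ℝ}
    (hQ : Q.PosDef) (hA : 1 < absDet A) {r : ℝ} (hr0 : 0 < r) (hr1 : r < 1)
    (hB : ∀ x, quadNorm Q ((invTr A).mulVec x) = r * quadNorm Q x) (m : ℕ) :
    Represents (toCplx fun ξ => phiHat A Q ξ ^ m) (fourierD d (phi A Q m)) := by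
  obtain ⟨C, N, hC, hb⟩ := exists_phiHat_le hQ hA hr0 hr1 hB
  have hm : Measurable fun ξ : Sp d => phiHat A Q (fun i => ξ i) ^ m :=
    ((measurable_phiHat hQ hA hr0 hr1 hB).comp
      (WithLp.measurable_ofLp 2 (Fin d → ℝ))).pow_const m
  have h0 := phiHat_nonneg hQ hA hr0 hr1 hB
  obtain ⟨T, hT⟩ := exists_represents (N := N * m) (C := C ^ m) hm
    (fun ξ => pow_nonneg (h0 _) m) fun ξ => by
      have hξ : ‖(fun i => ξ i : Fin d → ℝ)‖ ≤ ‖ξ‖ :=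
        (pi_norm_le_iff_of_nonneg (norm_nonneg ξ)).2 fun i => PiLp.norm_apply_le ξ i
      rw [pow_mul, ← mul_pow]
      refine pow_le_pow_left₀ (h0 _) ((hb _).trans ?_) m
      gcongr
  exact represents_invFourierOf hT

theorem HasSmoothSymbol.represents_pow {d : ℕ} {L : 𝓢'(Sp d, ℂ) →L[ℂ] 𝓢'(Sp d, ℂ)}
    {g f : Sp d → ℂ} {T : 𝓢'(Sp d, ℂ)} (hL : HasSmoothSymbol L g)
    (hf : Represents f (fourierD d T)) (k : ℕ) :
    Represents (fun ξ => g ξ ^ k * f ξ) (fourierD d ((L ^ k) T)) := by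
  induction k with
  | zero => simpa using hf
  | succ k ih =>
    have h : (L ^ (k + 1)) T = L ((L ^ k) T) := by
      rw [pow_succ']
      rfl
    rw [h, hL.2]
    convert ih.smulLeftCLM hL.1 using 1
    funext ξ
    rw [pow_succ', mul_assoc]

/-- This is the pointwise identity multiplied by G^k. Holding off the zeros of G is enough, since
representing functions matter only almost everywhere. -/
theorem deltaSharp_diffOp_pow_phi {d : ℕ} (hd : 0 < d) {A : Matrix (Fin d) (Fin d) ℤ}
    {Q : Matrix (Fin d) (Fin d) ℝ}
    (hQ : Q.PosDef) (hA : 1 < absDet A) {r : ℝ} (hr0 : 0 < r) (hr1 : r < 1)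
    (hB : ∀ x, quadNorm Q ((invTr A).mulVec x) = r * quadNorm Q x)
    (hrq : absDet A ^ ((2 : ℝ) / (d : ℝ)) * r ^ 2 = 1) {m : ℕ} (hm : m ≠ 0) (k : ℕ) :
    (diffOp Q ^ (k + 1)) (phi A Q m) ∈
      deltaSharp A Q ((diffOp Q ^ k) (phi A Q (m + 1))) := by
  refine mem_multiplier_iff.2 ⟨_, (hasSmoothSymbol_diffOp Q).represents_pow
    (represents_phi hQ hA hr0 hr1 hB (m + 1)) k, ?_⟩
  refine ((hasSmoothSymbol_diffOp Q).represents_pow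
    (represents_phi hQ hA hr0 hr1 hB m) (k + 1)).congr ?_
  filter_upwards [ae_trigPoly_ne_zero hd hQ] with ξ hξ
  have h := quadForm_div_bigM_mul_phiHat_pow hQ hA hr0 hr1 hB hrq hξ hm
  simp only [toCplx]
  norm_cast
  rw [pow_succ, mul_assoc, ← h]
  ring

end EllipticScaling

end

/-! ### Iteration of the one-step identity -/

open EllipticScaling in
theorem mainTheorem8 (d : ℕ) (hd : 0 < d)
    (A : Matrix (Fin d) (Fin d) ℤ) (hA : IsDilation A) (hiso : IsIsotropic (realMat A))
    (Q U : Matrix (Fin d) (Fin d) ℝ) (hQ : Q.PosDef)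
    (hU : U ∈ Matrix.orthogonalGroup (Fin d) ℝ)
    (hfac : invTr A = (1 / absDet A ^ (1 / (d : ℝ))) • (Q⁻¹ * U * Q)) :
    (∀ m : ℕ, 1 ≤ m →
      Represents (toCplx fun ξ => phiHat A Q ξ ^ m) (fourierD d (phi A Q m))) ∧
    HasSmoothSymbol (diffOp Q) (toCplx (trigPoly Q)) ∧
    ∀ m k : ℕ, k < m →
      partialPow (deltaSharp A Q) k (phi A Q m) =
        Part.some ((diffOp Q ^ k) (phi A Q (m - k))) := by
  have hA1 := one_lt_absDet hd hA
  have hd' : (0 : ℝ) < d := by exact_mod_cast hd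
  have hq1 : 1 < absDet A ^ (1 / (d : ℝ)) := Real.one_lt_rpow hA1 (by positivity)
  have hq0 : 0 < absDet A ^ (1 / (d : ℝ)) := one_pos.trans hq1
  have hr0 : 0 < 1 / absDet A ^ (1 / (d : ℝ)) := one_div_pos.2 hq0
  have hr1 : 1 / absDet A ^ (1 / (d : ℝ)) < 1 := (div_lt_one hq0).2 hq1
  have hB := quadNorm_mulVec_of_eq hQ hr0.le hU hfac
  have hrq : absDet A ^ ((2 : ℝ) / (d : ℝ)) * (1 / absDet A ^ (1 / (d : ℝ))) ^ 2 = 1 := by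
    have h : absDet A ^ ((2 : ℝ) / (d : ℝ)) = (absDet A ^ (1 / (d : ℝ))) ^ 2 := by
      rw [← Real.rpow_natCast, ← Real.rpow_mul (one_pos.trans hA1).le]
      congr 1
      push_cast
      ring
    rw [h, ← mul_pow, mul_one_div_cancel hq0.ne', one_pow]
  refine ⟨fun m _ => represents_phi hQ hA1 hr0 hr1 hB m, hasSmoothSymbol_diffOp Q, ?_⟩
  intro m k
  induction k with
  | zero => intro _; simp [partialPow]
  | succ k ih =>
    intro hk
    -- After k steps the exponent is n + 2, and the next step lowers it to n + 1, which is nonzero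
    -- as the one-step identity requires.
    obtain ⟨n, rfl⟩ : ∃ n, m = n + 1 + (k + 1) := ⟨m - (k + 2), by omega⟩
    have h1 : n + 1 + (k + 1) - k = n + 1 + 1 := by omega
    have h2 : n + 1 + (k + 1) - (k + 1) = n + 1 := by omega
    have h := deltaSharp_diffOp_pow_phi hd hQ hA1 hr0 hr1 hB hrq n.succ_ne_zero k
    rw [h1] at ih
    rw [partialPow, PFun.comp_apply, ih (by omega), h2]
    exact (Part.bind_some _ _).trans (Part.eq_some_iff.2 h)
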